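/- Let $A$ be a $C^*$-algebra (not necessarily unital) and let $E,F$ be Hilbert $C^*$-modules over $A$ (all on the same side; left and right modules are interchanged by passing to the opposite algebra). Write $\mathcal L(E,F)$ for the adjointable operators from $E$ to $F$, $\mathcal L(E)=\mathcal L(E,E)$. For a densely defined $A$-linear operator $T$ from within $E$ into $F$, the adjoint $T^*$ from within $F$ into $E$ has domain $$D(T^*)=\{v\in F\mid \exists\, w\in E:\ \langle Tu,v\rangle=\langle u,w\rangle \text{ for all } u\in D(T)\},$$ and $T^*v$ is the (unique) such $w$. The operator $T$ is called regular, $T\in\mathcal R(E,F)$, if it is $A$-linear, densely defined and closed, $T^*$ is densely defined, and $1+T^*T$ has dense range. A regular operator $T\in\mathcal R(E,F)$ is called invertible if $T$ is injective and $T^{-1}\in\mathcal R(F,E)$. An operator $T\in\mathcal R(E)=\mathcal R(E,E)$ is called normal if $D(T)=D(T^*)$ and $\langle Tv,Tv\rangle=\langle T^*v,T^*v\rangle$ for all $v\in D(T)$. Then: 1. For $T\in\mathcal R(E,F)$: $T$ is invertible if and only if both $T$ and $T^*$ have dense range. 2. For $T\in\mathcal R(E,F)$ there is a unique $z_T\in\mathcal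 L(E,F)$ with $\|z_T\|\le 1$ such that $D(T)=(1-z_T^*z_T)^{1/2}E$ and $T\bigl((1-z_T^*z_T)^{1/2}v\bigr)=z_Tv$ for all $v\in E$; and $T$ is invertible if and only if $z_T$ is invertible (as an element of $\mathcal R(E,F)$, i.e. $z_T$ is injective and $z_T^{-1}\in\mathcal R(F,E)$). 3. If $T\in\mathcal R(E)$ is normal, then $T$ is invertible if and only if $T$ has dense range. -/

import Mathlib

/-!
Regular operators between Hilbert C⋆-modules.

A Hilbert C⋆-module over the C⋆-algebra `A` is a type `E` with
`[NormedAddCommGroup E] [NormedSpace ℂ E] [SMul A E] [CStarModule A E] [CompleteSpace E]`;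
the class `CStarModule` contains the requirement that the norm of `E` is the one induced by the
`A`-valued inner product `inner A x y`.  Operators "from within `E` into `F`" are partially defined
linear maps `E →ₗ.[ℂ] F`.
-/

namespace HilbertModule

noncomputable section

variable (A : Type*) {E F : Type*}
  [NonUnitalCStarAlgebra A] [PartialOrder A]
  [NormedAddCommGroup E] [NormedSpace ℂ E] [SMul A E] [CStarModule A E]
  [NormedAddCommGroup F] [NormedSpace ℂ F] [SMul A F] [CStarModule A F]

/-- The (complex linear) partially defined operator `T` is `A`-linear: its domain is stable under
the action of `A` and `T` commutes with this action. -/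
def IsModuleLinear (T : E →ₗ.[ℂ] F) : Prop :=
  ∀ (a : A) (x : T.domain), ∃ h : a • (x : E) ∈ T.domain, T ⟨a • (x : E), h⟩ = a • T x

/-- The set of all `(v, w)` in `F × E` such that `⟨T u, v⟩ = ⟨u, w⟩` for every `u` in the domain
of `T`. -/
def adjointGraph (T : E →ₗ.[ℂ] F) : Submodule ℂ (F × E) where
  carrier := {p | ∀ u : T.domain, inner A (T u) p.1 = inner A (u : E) p.2}
  add_mem' {p q} hp hq u := by
    simp [hp u, hq u]
  zero_mem' u := by simp
  smul_mem' c p hp u := by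
    simp [hp u]

/-- The adjoint of a densely defined operator: its domain consists of all `v` for which there is
`w` with `⟨T u, v⟩ = ⟨u, w⟩` for every `u` in the domain of `T`, and it sends `v` to this `w`
(see `mem_graph_adjoint`). -/
def adjoint (T : E →ₗ.[ℂ] F) : F →ₗ.[ℂ] E :=
  (adjointGraph A T).toLinearPMap

/-- For densely defined `T`, the operator `adjoint A T` is the one described in its docstring. -/
theorem mem_graph_adjoint [StarOrderedRing A] {T : E →ₗ.[ℂ] F} (hT : Dense (T.domain : Set E))
    (v : F) (w : E) :
    (v, w) ∈ (adjoint A T).graph ↔ ∀ u : T.domain, inner A (T u) v = inner A (u : E) w := by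
  rw [adjoint, Submodule.toLinearPMap_graph_eq]
  · rfl
  · rintro ⟨v, w⟩ hvw rfl
    have h0 : ∀ u ∈ (T.domain : Set E), inner A u w = 0 := fun u hu => by
      have := hvw ⟨u, hu⟩
      simpa using this.symm
    have hc : Continuous fun u : E => inner A u w :=
      CStarModule.continuous_inner.comp (continuous_id.prodMk continuous_const)
    have h1 := hc.ext_on hT (continuous_const (y := (0 : A))) h0
    exact CStarModule.inner_self.mp (congrFun h1 w)

/-- The range of the operator `1 + T⋆T`, where `T⋆T` has domain
`{x ∈ D(T) | T x ∈ D(T⋆)}`. -/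
def rangeOneAddAdjointMul (T : E →ₗ.[ℂ] F) : Set E :=
  {y | ∃ (x : T.domain) (h : T x ∈ (adjoint A T).domain), y = x + adjoint A T ⟨T x, h⟩}

/-- `T` is a regular operator from within `E` into `F`, that is, `T ∈ R(E, F)`. -/
structure IsRegular (T : E →ₗ.[ℂ] F) : Prop where
  isModuleLinear : IsModuleLinear A T
  dense_domain : Dense (T.domain : Set E)
  isClosed : T.IsClosed
  dense_adjoint_domain : Dense ((adjoint A T).domain : Set F)
  dense_range : Dense (rangeOneAddAdjointMul A T)

/-- Invertibility of a regular operator: `T` is injective and `T⁻¹ ∈ R(F, E)`. -/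
def IsInvertible (T : E →ₗ.[ℂ] F) : Prop :=
  Function.Injective T ∧ IsRegular A T.inverse

/-- Normality: `D(T) = D(T⋆)` and `⟨T v, T v⟩ = ⟨T⋆ v, T⋆ v⟩` for every `v` in this domain. -/
def IsNormal (T : E →ₗ.[ℂ] E) : Prop :=
  T.domain = (adjoint A T).domain ∧
    ∀ (v : E) (h : v ∈ T.domain) (h' : v ∈ (adjoint A T).domain),
      inner A (T ⟨v, h⟩) (T ⟨v, h⟩) = inner A (adjoint A T ⟨v, h'⟩) (adjoint A T ⟨v, h'⟩)

/-- `z` and `w` are adjointable operators and `w = z⋆`. -/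
def IsAdjointPair (z : E →L[ℂ] F) (w : F →L[ℂ] E) : Prop :=
  ∀ x y, inner A (z x) y = inner A x (w y)

/-- `s` is a positive element of the C⋆-algebra `L(E)` of adjointable operators on `E`:
it is of the form `c⋆c` with `c ∈ L(E)`. -/
def IsPositive (s : E →L[ℂ] E) : Prop :=
  ∃ c d : E →L[ℂ] E, IsAdjointPair A c d ∧ s = d ∘L c

/-- `s = (1 - z⋆z)^(1/2)`, the positive square root in `L(E)`, for an adjointable `z`. -/
def IsSqrtOneSub (z : E →L[ℂ] F) (s : E →L[ℂ] E) : Prop :=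
  IsPositive A s ∧
    ∃ w : F →L[ℂ] E, IsAdjointPair A z w ∧ s ∘L s = ContinuousLinearMap.id ℂ E - w ∘L z

/-- `z` is the `z`-transform of `T`: it is an adjointable operator with `‖z‖ ≤ 1` such that
`D(T) = (1 - z⋆z)^(1/2) E` and `T ((1 - z⋆z)^(1/2) v) = z v` for every `v`. -/
def IsZTransform (T : E →ₗ.[ℂ] F) (z : E →L[ℂ] F) : Prop :=
  ‖z‖ ≤ 1 ∧ ∃ s : E →L[ℂ] E, IsSqrtOneSub A z s ∧
    (T.domain : Set E) = Set.range s ∧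
    ∀ (v : E) (h : s v ∈ T.domain), T ⟨s v, h⟩ = z v

/-- An everywhere defined bounded operator, seen as a partially defined one. -/
def ofCLM (z : E →L[ℂ] F) : E →ₗ.[ℂ] F :=
  (z : E →ₗ[ℂ] F).toPMap ⊤

end

end HilbertModule

namespace HilbertModule

open CStarModule Filter Topology

/-! ### Operators through their graphs -/

section Graph

variable {A E F : Type*} [SMul A E] [SMul A F]
  [NormedAddCommGroup E] [NormedSpace ℂ E] [NormedAddCommGroup F] [NormedSpace ℂ F]
  {T : E →ₗ.[ℂ] F}

/-! Everything rests on the resolvent `R = (1 + T⋆T)⁻¹` and `B = T R`. The quadratic form identity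
bounds `1 + T⋆T` from below, so on the closed space of triples `(x, T x, T⋆T x)` it is injective
with closed range; regularity makes this range dense, hence everything. Thus `R` and `B` are bounded
and everywhere defined. Orthogonal complements are not available in Hilbert modules, so
adjointability is obtained by solving the adjoint relation on the dense domain of `T⋆` and
extending.

The adjointable operators form a C⋆-algebra, so `R` has a positive root `s`, and `z` is the
continuous extension of `s y ↦ B y`; uniqueness of `s` gives uniqueness of `z`. From `x = R x + B⋆ T
x` one gets `T⋆⋆ = T`, and `1 + T T⋆` reaches `D(T⋆)`, so `T⋆` is regular.

Invertibility: the adjoint of `T⁻¹` is `(T⋆)⁻¹`, so dense ranges of `T` and `T⋆` are exactly the two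
density conditions for `T⁻¹`, and the last regularity condition is inherited from `1 + T T⋆`. The
ranges of `T` and `z` coincide, while `s T⋆ ⊆ z⋆` and `T⋆ z s = z⋆ z` compare those of `T⋆` and
`z⋆`. For normal `T`, polarization gives `T T⋆ ⊆ T⋆T`, and the range of `T T⋆` is dense in that of
`T`; hence density passes from `T` to `T⋆`. -/

theorem isModuleLinear_iff : IsModuleLinear A T ↔
    ∀ (a : A) x u, (x, u) ∈ T.graph → (a • x, a • u) ∈ T.graph := by
  constructor
  · intro h a x u hx
    obtain ⟨x, rfl, rfl⟩ := (LinearPMap.mem_graph_iff T).1 hx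
    obtain ⟨h1, h2⟩ := h a x
    rw [← h2]
    exact T.mem_graph ⟨_, h1⟩
  · intro h a x
    obtain ⟨x', h1, h2⟩ := (LinearPMap.mem_graph_iff T).1 (h a _ _ (T.mem_graph x))
    simp only at h1
    have h3 : a • (x : E) ∈ T.domain := h1 ▸ x'.2
    exact ⟨h3, (congrArg T (Subtype.ext h1.symm)).trans h2⟩

end Graph

variable {A E F G : Type*} [NonUnitalCStarAlgebra A] [PartialOrder A]
  [NormedAddCommGroup E] [NormedSpace ℂ E] [SMul A E] [CStarModule A E]
  [NormedAddCommGroup F] [NormedSpace ℂ F] [SMul A F] [CStarModule A F]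
  [NormedAddCommGroup G] [NormedSpace ℂ G] [SMul A G] [CStarModule A G]

variable (A) in
theorem inner_eq_swap {x y : E} {u v : F} (h : inner A x y = inner A u v) :
    inner A y x = inner A v u := by
  rw [← star_inner x y, h, star_inner]

/-! ### Adjointable operators -/

section AdjointPair

variable {z z' : E →L[ℂ] F} {w w' : F →L[ℂ] E}

theorem IsAdjointPair.symm (h : IsAdjointPair A z w) : IsAdjointPair A w z := fun x y => by
  rw [← star_inner, ← h y x, star_inner]

theorem IsAdjointPair.add (h : IsAdjointPair A z w) (h' : IsAdjointPair A z' w') :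
    IsAdjointPair A (z + z') (w + w') := fun x y => by simp [h x y, h' x y]

theorem IsAdjointPair.sub (h : IsAdjointPair A z w) (h' : IsAdjointPair A z' w') :
    IsAdjointPair A (z - z') (w - w') := fun x y => by simp [h x y, h' x y]

theorem IsAdjointPair.smul (h : IsAdjointPair A z w) (c : ℂ) :
    IsAdjointPair A (c • z) (star c • w) := fun x y => by simp [h x y]

theorem IsAdjointPair.comp {u : F →L[ℂ] G} {v : G →L[ℂ] F} (h' : IsAdjointPair A u v)
    (h : IsAdjointPair A z w) : IsAdjointPair A (u ∘L z) (w ∘L v) := fun x y => by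
  simp [h' (z x) y, h x (v y)]

theorem IsPositive.isAdjointPair {s : E →L[ℂ] E} (h : IsPositive A s) : IsAdjointPair A s s := by
  obtain ⟨c, d, h, rfl⟩ := h
  exact h.symm.comp h

end AdjointPair

section Adjointable

variable (A E)

/-- The algebra of adjointable operators on a Hilbert module. -/
def adjointable : Subalgebra ℂ (E →L[ℂ] E) where
  carrier := {z | ∃ w, IsAdjointPair A z w}
  mul_mem' := by
    rintro _ _ ⟨w, h⟩ ⟨w', h'⟩
    exact ⟨_, h.comp h'⟩
  add_mem' := by
    rintro _ _ ⟨w, h⟩ ⟨w', h'⟩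
    exact ⟨_, h.add h'⟩
  algebraMap_mem' c := ⟨algebraMap ℂ _ (star c), fun x y => by
    simp [ContinuousLinearMap.algebraMap_apply]⟩

variable {A E}

noncomputable instance : Star (adjointable A E) where
  star z := ⟨z.2.choose, z.1, z.2.choose_spec.symm⟩

theorem isAdjointPair_star (z : adjointable A E) :
    IsAdjointPair A (z : E →L[ℂ] E) (star z : adjointable A E) := z.2.choose_spec

end Adjointable

/-! ### Resolvent and bounded transform data -/

section Transform

variable {T : E →ₗ.[ℂ] F}

theorem mem_rangeOneAddAdjointMul {y : E} : y ∈ rangeOneAddAdjointMul A T ↔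
    ∃ x u w, (x, u) ∈ T.graph ∧ (u, w) ∈ (adjoint A T).graph ∧ x + w = y := by
  constructor
  · rintro ⟨x, h, rfl⟩
    exact ⟨x, T x, _, T.mem_graph x, (adjoint A T).mem_graph ⟨T x, h⟩, rfl⟩
  · rintro ⟨x, u, w, hx, hu, rfl⟩
    obtain ⟨x, rfl, rfl⟩ := (LinearPMap.mem_graph_iff T).1 hx
    obtain ⟨u, hu, rfl⟩ := (LinearPMap.mem_graph_iff _).1 hu
    simp only at hu
    exact ⟨x, hu ▸ u.2, by congr; exact Subtype.ext hu⟩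

/-- The operator identities relating `T`, `R = (1 + T⋆T)⁻¹` and `B = T R`. -/
structure IsResolvent (A : Type*) {E F : Type*} [NonUnitalCStarAlgebra A] [PartialOrder A]
    [NormedAddCommGroup E] [NormedSpace ℂ E] [SMul A E] [CStarModule A E]
    [NormedAddCommGroup F] [NormedSpace ℂ F] [SMul A F] [CStarModule A F]
    (T : E →ₗ.[ℂ] F) (R : E →L[ℂ] E) (B : E →L[ℂ] F) : Prop where
  dense_domain : Dense (T.domain : Set E)
  mem_graph : ∀ y, (R y, B y) ∈ T.graph
  mem_graph_adjoint : ∀ y, (B y, y - R y) ∈ (adjoint A T).graph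

theorem isZTransform_iff {z : E →L[ℂ] F} : IsZTransform A T z ↔ ‖z‖ ≤ 1 ∧ ∃ s, IsSqrtOneSub A z s ∧
    (∀ v, (s v, z v) ∈ T.graph) ∧ ∀ x ∈ T.domain, ∃ v, s v = x := by
  constructor
  · rintro ⟨h1, s, hs, hd, hT⟩
    refine ⟨h1, s, hs, fun v => ?_, fun x hx => ?_⟩
    · have hv : s v ∈ T.domain := by
        rw [← SetLike.mem_coe, hd]; exact ⟨v, rfl⟩
      rw [← hT v hv]
      exact T.mem_graph ⟨s v, hv⟩
    · rwa [← SetLike.mem_coe, hd] at hx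
  · rintro ⟨h1, s, hs, hg, hd⟩
    refine ⟨h1, s, hs, Set.Subset.antisymm hd ?_, fun v hv => ?_⟩
    · rintro _ ⟨v, rfl⟩
      exact LinearPMap.mem_domain_of_mem_graph (hg v)
    · exact T.mem_graph_snd_inj (T.mem_graph ⟨s v, hv⟩) (hg v) rfl

/-- `z` with adjoint `w` and `s = (1 - z⋆z)^(1/2)` form the bounded transform of `T`. -/
structure IsZData (A : Type*) {E F : Type*} [NonUnitalCStarAlgebra A] [PartialOrder A]
    [NormedAddCommGroup E] [NormedSpace ℂ E] [SMul A E] [CStarModule A E]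
    [NormedAddCommGroup F] [NormedSpace ℂ F] [SMul A F] [CStarModule A F]
    (T : E →ₗ.[ℂ] F) (z : E →L[ℂ] F) (w : F →L[ℂ] E) (s : E →L[ℂ] E) : Prop where
  isPositive : IsPositive A s
  isAdjointPair : IsAdjointPair A z w
  sqrt_sqrt_apply : ∀ y, s (s y) = y - w (z y)
  mem_graph : ∀ v, (s v, z v) ∈ T.graph
  exists_of_mem_graph : ∀ x u, (x, u) ∈ T.graph → ∃ v, s v = x ∧ z v = u

variable {z : E →L[ℂ] F} {w : F →L[ℂ] E} {s : E →L[ℂ] E}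

theorem IsZTransform.exists_isZData (h : IsZTransform A T z) : ∃ w s, IsZData A T z w s := by
  obtain ⟨-, s, ⟨hs, w, hw, hss⟩, hg, hd⟩ := isZTransform_iff.1 h
  refine ⟨w, s, hs, hw, fun y => congrArg (fun k => k y) hss, hg, fun x u hx => ?_⟩
  obtain ⟨v, rfl⟩ := hd x (LinearPMap.mem_domain_of_mem_graph hx)
  exact ⟨v, rfl, T.mem_graph_snd_inj (hg v) hx rfl⟩

theorem IsZData.range_eq (h : IsZData A T z w s) : Set.range T = Set.range z := by
  ext u
  rw [LinearPMap.mem_range_iff]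
  constructor
  · rintro ⟨x, hx⟩
    obtain ⟨v, -, rfl⟩ := h.exists_of_mem_graph x u hx
    exact ⟨v, rfl⟩
  · rintro ⟨v, rfl⟩
    exact ⟨s v, h.mem_graph v⟩

theorem IsZData.denseRange_iff (h : IsZData A T z w s) : DenseRange T ↔ DenseRange z := by
  rw [DenseRange, DenseRange, h.range_eq]

theorem IsZData.denseRange_sqrt (hT : Dense (T.domain : Set E)) (h : IsZData A T z w s) :
    DenseRange s := by
  refine hT.mono fun x hx => ?_
  obtain ⟨v, hv, -⟩ := h.exists_of_mem_graph x _ (T.mem_graph ⟨x, hx⟩)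
  exact ⟨v, hv⟩

end Transform

variable [StarOrderedRing A]

/-! ### Inner product estimates -/

section Inner

variable (A)

theorem ext_inner_of_dense {D : Set E} (hD : Dense D) {x y : E}
    (h : ∀ u ∈ D, inner A u x = inner A u y) : x = y := by
  have hc (w : E) : Continuous fun u : E => inner A u w :=
    CStarModule.continuous_inner.comp (continuous_id.prodMk continuous_const)
  have h1 := congrFun ((hc x).ext_on hD (hc y) h) (x - y)
  rw [← sub_eq_zero, ← CStarModule.inner_sub_right, inner_self, sub_eq_zero] at h1
  exact h1

theorem ext_inner {x y : E} (h : ∀ u, inner A u x = inner A u y) : x = y :=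
  ext_inner_of_dense A dense_univ fun u _ => h u

theorem norm_le_of_inner_self_le {x : E} {y : F} (h : inner A x x ≤ inner A y y) :
    ‖x‖ ≤ ‖y‖ := by
  rw [norm_eq_sqrt_norm_inner_self (A := A) x, norm_eq_sqrt_norm_inner_self (A := A) y]
  exact Real.sqrt_le_sqrt
    (CStarAlgebra.norm_le_norm_of_nonneg_of_le CStarModule.inner_self_nonneg h)

theorem norm_sq_le_of_inner_self_le {x : E} {y z : F} (h : inner A x x ≤ inner A y z) :
    ‖x‖ ^ 2 ≤ ‖y‖ * ‖z‖ := by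
  rw [norm_sq_eq A]
  exact (CStarAlgebra.norm_le_norm_of_nonneg_of_le CStarModule.inner_self_nonneg h).trans
    (CStarModule.norm_inner_le F)

end Inner

namespace IsAdjointPair

variable {z z' : E →L[ℂ] F} {w w' : F →L[ℂ] E}

theorem unique (h : IsAdjointPair A z w) (h' : IsAdjointPair A z w') : w = w' := by
  ext y
  exact ext_inner A fun u => by rw [← h, ← h']

theorem norm_le (h : IsAdjointPair A z w) : ‖w‖ ≤ ‖z‖ := by
  refine w.opNorm_le_bound (norm_nonneg _) fun y => ?_
  rcases eq_or_ne (w y) 0 with h0 | h0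
  · rw [h0, norm_zero]; positivity
  have h1 : ‖w y‖ * ‖w y‖ ≤ ‖z‖ * ‖y‖ * ‖w y‖ := calc
    ‖w y‖ * ‖w y‖ = ‖inner A (z (w y)) y‖ := by rw [h, ← norm_sq_eq A, sq]
    _ ≤ ‖z (w y)‖ * ‖y‖ := CStarModule.norm_inner_le F
    _ ≤ ‖z‖ * ‖w y‖ * ‖y‖ := by gcongr; exact z.le_opNorm _
    _ = _ := by ring
  exact le_of_mul_le_mul_right h1 (norm_pos_iff.2 h0)

theorem norm_eq (h : IsAdjointPair A z w) : ‖w‖ = ‖z‖ := le_antisymm h.norm_le h.symm.norm_le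

/-- Adjointable operators are module maps. -/
theorem map_smul (h : IsAdjointPair A z w) (a : A) (x : E) : z (a • x) = a • z x := by
  refine ext_inner A fun u => ?_
  rw [← h.symm u, inner_op_smul_right, inner_op_smul_right, h.symm u]

/-- `‖z‖² ≤ ‖z⋆z‖`. -/
theorem norm_mul_norm_le (h : IsAdjointPair A z w) : ‖z‖ * ‖z‖ ≤ ‖w ∘L z‖ := by
  have h1 : ‖z‖ ≤ √‖w ∘L z‖ := by
    refine z.opNorm_le_bound (Real.sqrt_nonneg _) fun x => ?_
    refine abs_le_of_sq_le_sq' ?_ (by positivity) |>.2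
    rw [mul_pow, Real.sq_sqrt (norm_nonneg _), norm_sq_eq A, h]
    calc ‖inner A x (w (z x))‖ ≤ ‖x‖ * ‖w (z x)‖ := CStarModule.norm_inner_le E
      _ ≤ ‖x‖ * (‖w ∘L z‖ * ‖x‖) := by gcongr; exact (w ∘L z).le_opNorm x
      _ = _ := by ring
  calc ‖z‖ * ‖z‖ ≤ √‖w ∘L z‖ * √‖w ∘L z‖ := by gcongr
    _ = _ := Real.mul_self_sqrt (norm_nonneg _)

end IsAdjointPair

/-- A bounded operator is adjointable as soon as its adjoint relation is solvable on a dense set. -/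
theorem exists_isAdjointPair_of_dense [CompleteSpace E] (z : E →L[ℂ] F) {D : Submodule ℂ F}
    (hD : Dense (D : Set F)) (h : ∀ v ∈ D, ∃ w, ∀ x, inner A (z x) v = inner A x w) :
    ∃ w : F →L[ℂ] E, IsAdjointPair A z w := by
  choose f hf using h
  let g : D →ₗ[ℂ] E :=
    { toFun v := f v v.2
      map_add' u v := ext_inner A fun x => by
        rw [← hf, CStarModule.inner_add_right, ← hf, ← hf, ← CStarModule.inner_add_right]; rfl
      map_smul' c v := ext_inner A fun x => by
        rw [← hf, RingHom.id_apply, inner_smul_right_complex, ← hf, ← inner_smul_right_complex]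
        rfl }
  have hg (v : D) (x : E) : inner A (z x) (v : F) = inner A x (g v) := hf v v.2 x
  have hb (v : D) : ‖g v‖ ≤ ‖z‖ * ‖D.subtype v‖ := by
    rcases eq_or_ne (g v) 0 with h0 | h0
    · rw [h0, norm_zero]; positivity
    have h1 : ‖g v‖ * ‖g v‖ ≤ ‖z‖ * ‖(v : F)‖ * ‖g v‖ := calc
      ‖g v‖ * ‖g v‖ = ‖inner A (z (g v)) (v : F)‖ := by rw [hg, ← norm_sq_eq A, sq]
      _ ≤ ‖z (g v)‖ * ‖(v : F)‖ := CStarModule.norm_inner_le F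
      _ ≤ ‖z‖ * ‖g v‖ * ‖(v : F)‖ := by gcongr; exact z.le_opNorm _
      _ = _ := by ring
    exact le_of_mul_le_mul_right h1 (norm_pos_iff.2 h0)
  have hd : DenseRange D.subtype := by simpa [DenseRange] using! hD
  refine ⟨g.extendOfNorm D.subtype, fun x y => ?_⟩
  refine hd.induction (P := fun y => inner A (z x) y = inner A x (g.extendOfNorm D.subtype y))
    ?_ ?_ y
  · rintro _ ⟨v, rfl⟩
    rw [LinearMap.extendOfNorm_eq hd ⟨_, hb⟩, ← hg]; rfl
  · exact isClosed_eq
      (CStarModule.continuous_inner.comp (by fun_prop : Continuous fun y : F => (z x, y)))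
      (CStarModule.continuous_inner.comp
        (by fun_prop : Continuous fun y : F => (x, g.extendOfNorm D.subtype y)))

/-! ### The C⋆-algebra of adjointable operators -/

section Algebra

theorem isClosed_adjointable [CompleteSpace E] :
    IsClosed (adjointable A E : Set (E →L[ℂ] E)) := by
  refine isClosed_of_closure_subset fun z hz => ?_
  obtain ⟨u, hu, hlim⟩ := mem_closure_iff_seq_limit.1 hz
  choose v hv using hu
  -- Passing to the adjoint is isometric, so the adjoints of a convergent sequence converge too.
  have hc : CauchySeq v := by
    have := hlim.cauchySeq
    rw [cauchySeq_iff_tendsto_dist_atTop_0] at this ⊢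
    refine this.congr fun p => ?_
    rw [dist_eq_norm, dist_eq_norm]
    exact ((hv p.1).sub (hv p.2)).norm_eq.symm
  obtain ⟨w, hw⟩ := cauchySeq_tendsto_of_complete hc
  refine ⟨w, fun x y => ?_⟩
  have h1 : Tendsto (fun n => inner A (u n x) y) atTop (𝓝 (inner A (z x) y)) :=
    (CStarModule.continuous_inner.tendsto (z x, y)).comp
      (((ContinuousLinearMap.apply ℂ E x).continuous.tendsto z |>.comp hlim).prodMk_nhds
        tendsto_const_nhds)
  have h2 : Tendsto (fun n => inner A x (v n y)) atTop (𝓝 (inner A x (w y))) :=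
    (CStarModule.continuous_inner.tendsto (x, w y)).comp
      (tendsto_const_nhds.prodMk_nhds
        ((ContinuousLinearMap.apply ℂ E y).continuous.tendsto w |>.comp hw))
  exact tendsto_nhds_unique h1 (h2.congr fun n => (hv n x y).symm)

theorem star_eq_of_isAdjointPair {z w : adjointable A E}
    (h : IsAdjointPair A (z : E →L[ℂ] E) w) : star z = w :=
  Subtype.ext ((isAdjointPair_star z).unique h)

noncomputable instance : StarRing (adjointable A E) where
  star_involutive z := star_eq_of_isAdjointPair (isAdjointPair_star z).symm
  star_mul z w := star_eq_of_isAdjointPair ((isAdjointPair_star z).comp (isAdjointPair_star w))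
  star_add z w := star_eq_of_isAdjointPair ((isAdjointPair_star z).add (isAdjointPair_star w))

instance : StarModule ℂ (adjointable A E) where
  star_smul c z := star_eq_of_isAdjointPair ((isAdjointPair_star z).smul c)

instance : CStarRing (adjointable A E) where
  norm_mul_self_le z := (isAdjointPair_star z).norm_mul_norm_le

noncomputable instance [CompleteSpace E] : CStarAlgebra (adjointable A E) where
  toCompleteSpace := isClosed_adjointable.completeSpace_coe

noncomputable instance [CompleteSpace E] : PartialOrder (adjointable A E) :=
  CStarAlgebra.spectralOrder _

instance [CompleteSpace E] : StarOrderedRing (adjointable A E) :=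
  CStarAlgebra.spectralOrderedRing _

end Algebra

/-! ### Positivity and square roots -/

section Positive

theorem isSelfAdjoint_of_isAdjointPair {a : adjointable A E}
    (h : IsAdjointPair A (a : E →L[ℂ] E) a) : IsSelfAdjoint a := star_eq_of_isAdjointPair h

variable [CompleteSpace E]

theorem isPositive_iff (s : E →L[ℂ] E) :
    IsPositive A s ↔ ∃ h : s ∈ adjointable A E, 0 ≤ (⟨s, h⟩ : adjointable A E) := by
  constructor
  · rintro ⟨c, d, h, rfl⟩
    refine ⟨mul_mem ⟨c, h.symm⟩ ⟨d, h⟩, ?_⟩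
    have : (⟨d ∘L c, mul_mem ⟨c, h.symm⟩ ⟨d, h⟩⟩ : adjointable A E) =
        star ⟨c, d, h⟩ * ⟨c, d, h⟩ := by
      rw [star_eq_of_isAdjointPair (z := ⟨c, d, h⟩) (w := ⟨d, c, h.symm⟩) h]; rfl
    rw [this]
    exact star_mul_self_nonneg _
  · rintro ⟨h, hs⟩
    obtain ⟨c, hc⟩ := CStarAlgebra.nonneg_iff_eq_star_mul_self.1 hs
    exact ⟨c, (star c : adjointable A E), isAdjointPair_star c, congrArg Subtype.val hc⟩

/-- A self-adjoint operator with nonnegative quadratic form is positive. -/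
theorem nonneg_of_inner_nonneg {a : adjointable A E} (ha : IsSelfAdjoint a)
    (h : ∀ x, 0 ≤ inner A ((a : E →L[ℂ] E) x) x) : 0 ≤ a := by
  rw [← CFC.negPart_eq_zero_iff a ha]
  set n := a⁻ with hn
  have hn0 : 0 ≤ n := CFC.negPart_nonneg a
  have hns : IsAdjointPair A (n : E →L[ℂ] E) n := by
    simpa [(IsSelfAdjoint.of_nonneg hn0).star_eq] using isAdjointPair_star n
  obtain ⟨b, hb⟩ := CStarAlgebra.nonneg_iff_eq_star_mul_self.1 hn0
  have hbp := isAdjointPair_star b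
  have hnb (x : E) : (n : E →L[ℂ] E) x = (star b : adjointable A E).1 (b.1 x) := by
    rw [hb]; rfl
  -- With `n` the negative part, `a n = -n²`. Testing the form of `a` at `n x` and writing `n = b⋆b`
  -- gives `⟨b n x, b n x⟩ ≤ 0`, so `b n = 0`, then `n² = b⋆ b n = 0` and `n = 0`.
  have hmul : a * n = -(n * n) := by
    conv_lhs => rw [← CFC.posPart_sub_negPart a ha, sub_mul, CFC.posPart_mul_negPart, ← hn]
    simp
  have hmul' (x : E) : a.1 (n.1 x) = -n.1 (n.1 x) := congrArg (fun c => c.1 x) hmul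
  have hbn (x : E) : b.1 (n.1 x) = 0 := by
    refine inner_self.1 (le_antisymm ?_ (CStarModule.inner_self_nonneg (A := A)))
    have h1 := h (n.1 x)
    rw [hmul', CStarModule.inner_neg_left, hnb (n.1 x), hbp.symm] at h1
    exact neg_nonneg.1 h1
  ext x
  refine inner_self.1 (?_ : inner A (n.1 x) (n.1 x) = 0)
  rw [hns, hnb (n.1 x), hbn]
  simp

/-- Positive square roots of adjointable operators are unique. -/
theorem IsPositive.eq_of_comp_self_eq {s t : E →L[ℂ] E} (hs : IsPositive A s)
    (ht : IsPositive A t) (h : s ∘L s = t ∘L t) : s = t := by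
  obtain ⟨hs, hs0⟩ := (isPositive_iff s).1 hs
  obtain ⟨ht, ht0⟩ := (isPositive_iff t).1 ht
  have h1 : (⟨s, hs⟩ : adjointable A E) * ⟨s, hs⟩ = ⟨t, ht⟩ * ⟨t, ht⟩ := Subtype.ext h
  have := (CFC.sqrt_mul_self _ hs0).symm.trans ((congrArg CFC.sqrt h1).trans
    (CFC.sqrt_mul_self _ ht0))
  exact congrArg Subtype.val this

/-- A self-adjoint operator with nonnegative quadratic form has a positive square root. -/
theorem exists_isPositive_comp_self_eq {r : E →L[ℂ] E} (hr : IsAdjointPair A r r)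
    (h : ∀ x, 0 ≤ inner A (r x) x) : ∃ s, IsPositive A s ∧ s ∘L s = r := by
  have h0 : 0 ≤ (⟨r, r, hr⟩ : adjointable A E) :=
    nonneg_of_inner_nonneg (isSelfAdjoint_of_isAdjointPair hr) h
  refine ⟨(CFC.sqrt (⟨r, r, hr⟩ : adjointable A E)).1,
    (isPositive_iff _).2 ⟨Subtype.property _, CFC.sqrt_nonneg _⟩, ?_⟩
  exact congrArg Subtype.val (CFC.sqrt_mul_sqrt_self _ h0)

/-- `c + z⋆z` is surjective for `c > 0`. -/
theorem IsAdjointPair.surjective_smul_add {z : E →L[ℂ] F} {w : F →L[ℂ] E}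
    (h : IsAdjointPair A z w) {c : ℝ} (hc : 0 < c) (y : E) : ∃ x, c • x + w (z x) = y := by
  have hp : IsAdjointPair A (w ∘L z) (w ∘L z) := h.symm.comp h
  have h0 : 0 ≤ (⟨w ∘L z, _, hp⟩ : adjointable A E) := by
    refine nonneg_of_inner_nonneg (isSelfAdjoint_of_isAdjointPair hp) fun x => ?_
    change 0 ≤ inner A (w (z x)) x
    rw [h.symm]
    exact CStarModule.inner_self_nonneg
  have h1 : IsStrictlyPositive (algebraMap ℝ (adjointable A E) c) :=
    isStrictlyPositive_algebraMap hc
  obtain ⟨u, hu⟩ := (h1.add_nonneg h0).isUnit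
  refine ⟨(↑u⁻¹ : adjointable A E).1 y, ?_⟩
  have h2 : (algebraMap ℝ (adjointable A E) c + ⟨w ∘L z, _, hp⟩) *
      (↑u⁻¹ : adjointable A E) = 1 := by
    rw [← hu]; simp
  have h3 := congrArg (fun k : adjointable A E => k.1 y) h2
  simpa [Algebra.algebraMap_eq_smul_one] using! h3

end Positive

/-! ### The adjoint and the quadratic form of `1 + T⋆T` -/

section Adjoint

variable {T : E →ₗ.[ℂ] F}

theorem mem_graph_adjoint_iff (hT : Dense (T.domain : Set E)) {v : F} {w : E} :
    (v, w) ∈ (adjoint A T).graph ↔ ∀ x u, (x, u) ∈ T.graph → inner A u v = inner A x w := by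
  rw [mem_graph_adjoint A hT]
  constructor
  · intro h x u hxu
    obtain ⟨x', rfl, rfl⟩ := (LinearPMap.mem_graph_iff T).1 hxu
    exact h x'
  · exact fun h u => h _ _ (T.mem_graph u)

theorem isClosed_adjoint (hT : Dense (T.domain : Set E)) : (adjoint A T).IsClosed := by
  have : ((adjoint A T).graph : Set (F × E)) =
      ⋂ u : T.domain, {p | inner A (T u) p.1 = inner A (u : E) p.2} := by
    ext p
    simp only [SetLike.mem_coe, Set.mem_iInter, Set.mem_ofPred_eq]
    exact mem_graph_adjoint A hT p.1 p.2
  rw [LinearPMap.IsClosed, this]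
  exact isClosed_iInter fun u => isClosed_eq
    (CStarModule.continuous_inner.comp (by fun_prop : Continuous fun p : F × E => (T u, p.1)))
    (CStarModule.continuous_inner.comp (by fun_prop : Continuous fun p : F × E => ((u : E), p.2)))

theorem isModuleLinear_adjoint (hT : Dense (T.domain : Set E)) : IsModuleLinear A (adjoint A T) :=
  isModuleLinear_iff.2 fun a v w h => (mem_graph_adjoint_iff hT).2 fun x u hx => by
    rw [inner_op_smul_right, inner_op_smul_right, (mem_graph_adjoint_iff hT).1 h x u hx]

/-- The quadratic form identity `⟨x, (1 + T⋆T) x⟩ = ⟨x, x⟩ + ⟨T x, T x⟩`. -/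
theorem inner_add_adjoint (hT : Dense (T.domain : Set E)) {x w : E} {u : F}
    (hx : (x, u) ∈ T.graph) (hu : (u, w) ∈ (adjoint A T).graph) :
    inner A x (x + w) = inner A x x + inner A u u := by
  rw [CStarModule.inner_add_right, (mem_graph_adjoint_iff hT).1 hu x u hx]

/-- Cauchy–Schwarz applied to `⟨x, x⟩ ≤ ⟨x, (1 + T⋆T) x⟩`: this is the lower bound that makes `1 +
T⋆T` invertible. -/
theorem norm_fst_le_norm_add_adjoint (hT : Dense (T.domain : Set E)) {x w : E} {u : F}
    (hx : (x, u) ∈ T.graph) (hu : (u, w) ∈ (adjoint A T).graph) : ‖x‖ ≤ ‖x + w‖ := by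
  have h : inner A x x ≤ inner A x (x + w) := by
    rw [inner_add_adjoint hT hx hu]
    exact le_add_of_nonneg_right CStarModule.inner_self_nonneg
  have h1 := norm_sq_le_of_inner_self_le A h
  nlinarith [norm_nonneg x, norm_nonneg (x + w)]

theorem norm_snd_le_norm_add_adjoint (hT : Dense (T.domain : Set E)) {x w : E} {u : F}
    (hx : (x, u) ∈ T.graph) (hu : (u, w) ∈ (adjoint A T).graph) : ‖u‖ ≤ ‖x + w‖ := by
  have h : inner A u u ≤ inner A x (x + w) := by
    rw [inner_add_adjoint hT hx hu]
    exact le_add_of_nonneg_left CStarModule.inner_self_nonneg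
  have h1 := norm_sq_le_of_inner_self_le A h
  have h2 := norm_fst_le_norm_add_adjoint hT hx hu
  refine abs_le_of_sq_le_sq' (h1.trans ?_) (norm_nonneg _) |>.2
  rw [sq]
  gcongr

/-- `1 + T⋆T` is injective. -/
theorem eq_of_add_adjoint_eq (hT : Dense (T.domain : Set E)) {x w x' w' : E} {u u' : F}
    (hx : (x, u) ∈ T.graph) (hu : (u, w) ∈ (adjoint A T).graph)
    (hx' : (x', u') ∈ T.graph) (hu' : (u', w') ∈ (adjoint A T).graph)
    (h : x + w = x' + w') : x = x' := by
  have := norm_fst_le_norm_add_adjoint hT (T.graph.sub_mem hx hx')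
    ((adjoint A T).graph.sub_mem hu hu')
  have h0 : x - x' + (w - w') = 0 := by rw [sub_add_sub_comm, h, sub_self]
  rwa [h0, norm_zero, norm_le_zero_iff, sub_eq_zero] at this

end Adjoint

/-! ### Regular operators: the resolvent and existence of the transform -/

section Regular

variable {T : E →ₗ.[ℂ] F}

/-- The bounded operators `R = (1 + T⋆T)⁻¹` and `B = T R`. -/
theorem IsRegular.exists_isResolvent [CompleteSpace E] [CompleteSpace F] (hT : IsRegular A T) :
    ∃ R B, IsResolvent A T R B := by
  let M : Submodule ℂ (E × F × E) :=
    T.graph.comap ((LinearMap.fst ℂ E (F × E)).prod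
      (LinearMap.fst ℂ F E ∘ₗ LinearMap.snd ℂ E (F × E))) ⊓
    (adjoint A T).graph.comap (LinearMap.snd ℂ E (F × E))
  have hMc : IsClosed (M : Set (E × F × E)) :=
    (hT.isClosed.preimage (by fun_prop : Continuous fun p : E × F × E => (p.1, p.2.1))).inter
      ((isClosed_adjoint hT.dense_domain).preimage continuous_snd)
  have : CompleteSpace M := hMc.completeSpace_coe
  let q : M →L[ℂ] E := (ContinuousLinearMap.fst ℂ E (F × E) +
    ContinuousLinearMap.snd ℂ F E ∘L ContinuousLinearMap.snd ℂ E (F × E)) ∘L M.subtypeL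
  have hq (p : M) : q p = p.1.1 + p.1.2.2 := rfl
  -- The first two entries are bounded by `‖q p‖`; the third is `q p` minus the first, whence the
  -- constant 2.
  have hb (p : M) : ‖p‖ ≤ (2 : NNReal) * ‖q p‖ := by
    have h1 : ‖p.1.1‖ ≤ ‖q p‖ := norm_fst_le_norm_add_adjoint hT.dense_domain p.2.1 p.2.2
    have h2 : ‖p.1.2.1‖ ≤ ‖q p‖ := norm_snd_le_norm_add_adjoint hT.dense_domain p.2.1 p.2.2
    have h3 : ‖p.1.2.2‖ ≤ ‖q p‖ + ‖p.1.1‖ := by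
      have := norm_sub_le (q p) p.1.1
      rwa [hq, add_sub_cancel_left] at this
    rw [← Submodule.norm_coe, Prod.norm_def, Prod.norm_def]
    have h4 := norm_nonneg (q p)
    simp only [NNReal.coe_ofNat]
    refine max_le ?_ (max_le ?_ ?_) <;> linarith
  have ha : AntilipschitzWith 2 q := AddMonoidHomClass.antilipschitz_of_bound q hb
  have hsurj : Function.Surjective q := by
    have hd : DenseRange q := by
      refine hT.dense_range.mono fun y hy => ?_
      obtain ⟨x, u, w, hx, hu, rfl⟩ := mem_rangeOneAddAdjointMul.1 hy
      exact ⟨⟨(x, u, w), hx, hu⟩, rfl⟩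
    rw [← Set.range_eq_univ, ← hd.closure_range]
    exact (ha.isClosed_range q.uniformContinuous).closure_eq.symm
  let e := ContinuousLinearEquiv.ofBijective q (LinearMap.ker_eq_bot.2 ha.injective)
    (LinearMap.range_eq_top.2 hsurj)
  have he (y : E) : (e.symm y).1.1 + (e.symm y).1.2.2 = y := e.apply_symm_apply y
  refine ⟨ContinuousLinearMap.fst ℂ E (F × E) ∘L M.subtypeL ∘L e.symm,
    ContinuousLinearMap.fst ℂ F E ∘L ContinuousLinearMap.snd ℂ E (F × E) ∘L M.subtypeL ∘L e.symm,
    hT.dense_domain, fun y => (e.symm y).2.1, fun y => ?_⟩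
  have h1 := (e.symm y).2.2
  have h2 : (e.symm y).1.2.2 = y - (e.symm y).1.1 := eq_sub_of_add_eq' (he y)
  change ((e.symm y).1.2.1, y - (e.symm y).1.1) ∈ _
  rw [← h2]
  exact h1

namespace IsResolvent

variable {R : E →L[ℂ] E} {B : E →L[ℂ] F}

theorem inner_apply (h : IsResolvent A T R B) {x : E} {u : F} (hx : (x, u) ∈ T.graph) (y : E) :
    inner A u (B y) = inner A x (y - R y) :=
  (mem_graph_adjoint_iff h.dense_domain).1 (h.mem_graph_adjoint y) x u hx

theorem inner_eq (h : IsResolvent A T R B) (y y' : E) :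
    inner A (R y) y' = inner A (B y) (B y') + inner A (R y) (R y') := by
  rw [h.inner_apply (h.mem_graph y), CStarModule.inner_sub_right, sub_add_cancel]

theorem isAdjointPair (h : IsResolvent A T R B) : IsAdjointPair A R R := fun y y' => by
  rw [← star_inner (R y') y, h.inner_eq y, h.inner_eq y', star_add, star_inner, star_inner]

theorem inner_nonneg (h : IsResolvent A T R B) (y : E) : 0 ≤ inner A (R y) y := by
  rw [h.inner_eq]
  exact add_nonneg CStarModule.inner_self_nonneg CStarModule.inner_self_nonneg

theorem inner_snd_of_mem_adjoint (h : IsResolvent A T R B) {v : F} {w : E}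
    (hv : (v, w) ∈ (adjoint A T).graph) (y : E) : inner A (B y) v = inner A y (R w) := by
  rw [(mem_graph_adjoint_iff h.dense_domain).1 hv _ _ (h.mem_graph y), h.isAdjointPair]

theorem exists_adjoint [CompleteSpace E] (h : IsResolvent A T R B)
    (hd : Dense ((adjoint A T).domain : Set F)) :
    ∃ C, IsAdjointPair A B C :=
  exists_isAdjointPair_of_dense B hd fun v hv =>
    ⟨_, h.inner_snd_of_mem_adjoint ((adjoint A T).mem_graph ⟨v, hv⟩)⟩

/-- `x = R x + B⋆ T x` on the domain of `T`; more generally this holds on the domain of `T⋆⋆`. -/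
theorem eq_add (h : IsResolvent A T R B) {C : F →L[ℂ] E} (hC : IsAdjointPair A B C) {x : E} {u : F}
    (hx : ∀ v w, (v, w) ∈ (adjoint A T).graph → inner A w x = inner A v u) :
    R x + C u = x := by
  refine ext_inner A fun y => ?_
  rw [CStarModule.inner_add_right, ← hC, ← h.isAdjointPair, ← hx _ _ (h.mem_graph_adjoint y),
    CStarModule.inner_sub_left]
  abel

theorem apply_of_mem_adjoint (h : IsResolvent A T R B) {C : F →L[ℂ] E} (hC : IsAdjointPair A B C)
    {v : F} {w : E} (hv : (v, w) ∈ (adjoint A T).graph) : C v = R w :=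
  ext_inner A fun y => by rw [← hC, h.inner_snd_of_mem_adjoint hv]

end IsResolvent

theorem inner_adjoint_swap (hT : Dense (T.domain : Set E)) {x : E} {u : F}
    (hx : (x, u) ∈ T.graph) {v : F} {w : E} (hv : (v, w) ∈ (adjoint A T).graph) :
    inner A w x = inner A v u :=
  (inner_eq_swap A ((mem_graph_adjoint_iff hT).1 hv x u hx)).symm

/-- The domain of `T⋆T` is dense. -/
theorem IsRegular.denseRange_resolvent [CompleteSpace E] (hT : IsRegular A T)
    {R : E →L[ℂ] E} {B : E →L[ℂ] F}
    (h : IsResolvent A T R B) : DenseRange R := by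
  obtain ⟨C, hC⟩ := h.exists_adjoint hT.dense_adjoint_domain
  let K : Submodule ℂ E := R.range.topologicalClosure
  have hK : (K : Set E) = closure (Set.range R) := rfl
  -- On `D(T⋆)` one has `C v = R T⋆ v`; density and continuity extend the inclusion to all of `F`.
  have hCK (u : F) : C u ∈ K := by
    have hcl : IsClosed {u | C u ∈ K} :=
      (Submodule.isClosed_topologicalClosure _).preimage C.continuous
    refine hcl.closure_subset_iff.2 (fun v hv => ?_) (hT.dense_adjoint_domain u)
    rw [Set.mem_ofPred_eq, h.apply_of_mem_adjoint hC ((adjoint A T).mem_graph ⟨v, hv⟩)]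
    exact Submodule.le_topologicalClosure _ ⟨_, rfl⟩
  refine dense_closure.1 (hK ▸ hT.dense_domain.mono fun x hx => ?_)
  have hxe : R x + C (T ⟨x, hx⟩) = x := h.eq_add hC fun v w hv =>
    inner_adjoint_swap hT.dense_domain (T.mem_graph ⟨x, hx⟩) hv
  rw [SetLike.mem_coe, ← hxe]
  exact K.add_mem (Submodule.le_topologicalClosure _ ⟨_, rfl⟩) (hCK _)

theorem IsRegular.exists_isZTransform [CompleteSpace E] [CompleteSpace F] (hT : IsRegular A T) :
    ∃ z : E →L[ℂ] F, IsZTransform A T z := by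
  obtain ⟨R, B, h⟩ := hT.exists_isResolvent
  obtain ⟨s, hs, hsR⟩ := exists_isPositive_comp_self_eq h.isAdjointPair h.inner_nonneg
  have hss (y : E) : s (s y) = R y := by rw [← hsR]; rfl
  have hsa := hs.isAdjointPair
  have hds : DenseRange s := (hT.denseRange_resolvent h).mono <| by
    rintro _ ⟨y, rfl⟩
    exact ⟨s y, hss y⟩
  -- Since `⟨s y, s y⟩ = ⟨R y, y⟩ = ⟨B y, B y⟩ + ⟨R y, R y⟩`, the map `s y ↦ B y` is a well-defined
  -- contraction.
  have hb (y : E) : ‖B.toLinearMap y‖ ≤ 1 * ‖s.toLinearMap y‖ := by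
    rw [one_mul]
    refine norm_le_of_inner_self_le A (?_ : inner A (B y) (B y) ≤ inner A (s y) (s y))
    rw [← hsa.symm, hss, h.inner_eq]
    exact le_add_of_nonneg_right CStarModule.inner_self_nonneg
  let z : E →L[ℂ] F := B.toLinearMap.extendOfNorm s.toLinearMap
  have hzs (y : E) : z (s y) = B y := LinearMap.extendOfNorm_eq (e := s.toLinearMap) hds ⟨1, hb⟩ y
  have hg (v : E) : (s v, z v) ∈ T.graph := by
    refine hds.induction (P := fun v => (s v, z v) ∈ T.graph) ?_ ?_ v
    · rintro _ ⟨y, rfl⟩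
      rw [hss, hzs]
      exact h.mem_graph y
    · exact hT.isClosed.preimage (s.continuous.prodMk z.continuous)
  obtain ⟨w, hw⟩ := exists_isAdjointPair_of_dense (A := A) z hT.dense_adjoint_domain
    fun v hv => ⟨s (adjoint A T ⟨v, hv⟩), fun x => by
      rw [(mem_graph_adjoint_iff hT.dense_domain).1 ((adjoint A T).mem_graph ⟨v, hv⟩) _ _ (hg x),
        hsa]⟩
  obtain ⟨C, hC⟩ := h.exists_adjoint hT.dense_adjoint_domain
  have hCsw : C = s ∘L w := hC.unique <| by
    have : B = z ∘L s := by ext y; exact (hzs y).symm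
    rw [this]
    exact hw.comp hsa
  refine ⟨z, isZTransform_iff.2 ⟨?_, s, ⟨hs, w, hw, ?_⟩, hg, fun x hx => ?_⟩⟩
  · exact LinearMap.opNorm_extendOfNorm_le (e := s.toLinearMap) hds zero_le_one hb
  · refine ContinuousLinearMap.ext fun x => ?_
    refine hds.induction (P := fun x => (s ∘L s) x = (ContinuousLinearMap.id ℂ E - w ∘L z) x)
      ?_ (isClosed_eq (by fun_prop) (by fun_prop)) x
    rintro _ ⟨y, rfl⟩
    have h1 : w (B y) = s (y - R y) := by
      refine ext_inner_of_dense A hds ?_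
      rintro _ ⟨y', rfl⟩
      rw [← hw, hzs, h.inner_apply (h.mem_graph y'), ← hsa, hss]
    simp only [ContinuousLinearMap.comp_apply, sub_apply,
      ContinuousLinearMap.id_apply]
    rw [hzs, h1, map_sub, hss y]
    abel
  -- The preimage is read off from `x = R x + B⋆ T x` with `R = s²` and `B⋆ = s z⋆`.
  · refine ⟨s x + w (T ⟨x, hx⟩), ?_⟩
    rw [map_add, hss]
    have := h.eq_add hC (fun v w hv =>
      inner_adjoint_swap hT.dense_domain (T.mem_graph ⟨x, hx⟩) hv)
    rwa [hCsw] at this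

end Regular

/-! ### Uniqueness of the transform, double adjoint, regularity of the adjoint -/

section ZTransform

variable {T : E →ₗ.[ℂ] F}

namespace IsZData

theorem mem_graph_adjoint (hT : Dense (T.domain : Set E)) (h : IsZData A T z w s) (y : E) :
    (z (s y), w (z y)) ∈ (adjoint A T).graph := by
  refine (mem_graph_adjoint_iff hT).2 fun x u hx => ?_
  obtain ⟨v, rfl, rfl⟩ := h.exists_of_mem_graph x u hx
  -- `z⋆z = 1 - s²` commutes with `s`.
  have h1 : w (z (s y)) = s (w (z y)) := by
    rw [← sub_sub_cancel (s y) (w (z (s y))), ← h.sqrt_sqrt_apply, h.sqrt_sqrt_apply y, map_sub,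
      sub_sub_cancel]
  rw [h.isAdjointPair, h1, h.isPositive.isAdjointPair v]

theorem isResolvent (hT : Dense (T.domain : Set E)) (h : IsZData A T z w s) :
    IsResolvent A T (s ∘L s) (z ∘L s) where
  dense_domain := hT
  mem_graph y := h.mem_graph (s y)
  mem_graph_adjoint y := by
    have := h.mem_graph_adjoint hT y
    rwa [← sub_sub_cancel y (w (z y)), ← h.sqrt_sqrt_apply] at this

end IsZData

theorem IsZTransform.unique [CompleteSpace E] (hT : Dense (T.domain : Set E)) {z' : E →L[ℂ] F}
    (h : IsZTransform A T z) (h' : IsZTransform A T z') : z = z' := by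
  obtain ⟨w, s, h⟩ := h.exists_isZData
  obtain ⟨w', s', h'⟩ := h'.exists_isZData
  -- Both squares equal `(1 + T⋆T)⁻¹`, which `T` determines, and positive roots are unique.
  have hs : s = s' := by
    refine h.isPositive.eq_of_comp_self_eq h'.isPositive (ContinuousLinearMap.ext fun y => ?_)
    have h1 := h.isResolvent hT
    have h2 := h'.isResolvent hT
    exact eq_of_add_adjoint_eq hT (h1.mem_graph y) (h1.mem_graph_adjoint y) (h2.mem_graph y)
      (h2.mem_graph_adjoint y) (by abel)
  subst hs
  ext v
  exact T.mem_graph_snd_inj (h.mem_graph v) (h'.mem_graph v) rfl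

variable [CompleteSpace E] [CompleteSpace F]

/-- A regular operator equals its double adjoint. -/
theorem IsRegular.adjoint_adjoint (hT : IsRegular A T) : adjoint A (adjoint A T) = T := by
  refine LinearPMap.eq_of_eq_graph (Submodule.ext fun ⟨x, u⟩ => ?_)
  rw [mem_graph_adjoint_iff hT.dense_adjoint_domain]
  refine ⟨fun h => ?_, fun h v w hv => inner_adjoint_swap hT.dense_domain h hv⟩
  obtain ⟨z, hz⟩ := hT.exists_isZTransform
  obtain ⟨w, s, hz⟩ := hz.exists_isZData
  have hx : s (s x) + s (w u) = x := (hz.isResolvent hT.dense_domain).eq_add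
    (hz.isAdjointPair.comp hz.isPositive.isAdjointPair) h
  have hg := hz.mem_graph (s x + w u)
  rw [map_add, hx] at hg
  -- Both sides have the same inner products `⟨T⋆v, x⟩` with each `v` in the dense domain of `T⋆`.
  have hu : u = z (s x + w u) := ext_inner_of_dense A hT.dense_adjoint_domain fun v hv => by
    have hv := (adjoint A T).mem_graph ⟨v, hv⟩
    exact (h _ _ hv).symm.trans (inner_adjoint_swap hT.dense_domain hg hv)
  rwa [hu]

/-- `1 + T T⋆` reaches the domain of `T⋆`. -/
theorem IsRegular.exists_add_eq (hT : IsRegular A T) {v : F} (hv : v ∈ (adjoint A T).domain) :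
    ∃ v' x u, (v', x) ∈ (adjoint A T).graph ∧ (x, u) ∈ T.graph ∧ v' + u = v := by
  obtain ⟨R, B, h⟩ := hT.exists_isResolvent
  have hg := (adjoint A T).mem_graph ⟨v, hv⟩
  set y := adjoint A T ⟨v, hv⟩
  -- With `y = T⋆v`: `T⋆(v - B y) = y - (y - R y) = R y`, and `T R y = B y`.
  refine ⟨v - B y, R y, B y, ?_, h.mem_graph y, sub_add_cancel _ _⟩
  have := (adjoint A T).graph.sub_mem hg (h.mem_graph_adjoint y)
  rwa [Prod.mk_sub_mk, sub_sub_cancel] at this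

theorem IsRegular.adjoint (hT : IsRegular A T) : IsRegular A (adjoint A T) where
  isModuleLinear := isModuleLinear_adjoint hT.dense_domain
  dense_domain := hT.dense_adjoint_domain
  isClosed := isClosed_adjoint hT.dense_domain
  dense_adjoint_domain := hT.adjoint_adjoint.symm ▸ hT.dense_domain
  dense_range := hT.dense_adjoint_domain.mono fun v hv => by
    obtain ⟨v', x, u, h1, h2, h3⟩ := hT.exists_add_eq hv
    exact mem_rangeOneAddAdjointMul.2 ⟨v', x, u, h1, hT.adjoint_adjoint.symm ▸ h2, h3⟩

end ZTransform

/-! ### Invertibility through dense ranges -/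

section Inverse

variable {T : E →ₗ.[ℂ] F}

theorem mem_graph_inverse (hi : Function.Injective T) {x : E} {u : F} :
    (u, x) ∈ T.inverse.graph ↔ (x, u) ∈ T.graph := by
  rw [LinearPMap.inverse_graph (LinearMap.ker_eq_bot.2 hi)]
  constructor
  · rintro ⟨⟨x', u'⟩, h, heq⟩
    obtain ⟨rfl, rfl⟩ := Prod.mk.inj heq
    exact h
  · exact fun h => ⟨(x, u), h, rfl⟩

theorem coe_inverse_domain : (T.inverse.domain : Set F) = Set.range T := by
  rw [LinearPMap.inverse_domain]; rfl

theorem mem_graph_adjoint_inverse (hT : Dense (T.domain : Set E)) (hi : Function.Injective T)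
    (hd : DenseRange T) {v : F} {w : E} :
    (w, v) ∈ (adjoint A T.inverse).graph ↔ (v, w) ∈ (adjoint A T).graph := by
  rw [mem_graph_adjoint_iff hT, mem_graph_adjoint_iff (by rwa [coe_inverse_domain])]
  simp only [mem_graph_inverse hi]
  exact ⟨fun h x u hx => (h u x hx).symm, fun h u x hx => (h x u hx).symm⟩

theorem coe_adjoint_inverse_domain (hT : Dense (T.domain : Set E)) (hi : Function.Injective T)
    (hd : DenseRange T) : ((adjoint A T.inverse).domain : Set E) = Set.range (adjoint A T) := by
  ext w
  rw [SetLike.mem_coe, LinearPMap.mem_domain_iff, LinearPMap.mem_range_iff]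
  simp only [mem_graph_adjoint_inverse hT hi hd]

theorem injective_of_denseRange_adjoint (hT : Dense (T.domain : Set E))
    (hd : DenseRange (adjoint A T)) : Function.Injective T := by
  change Function.Injective T.toFun
  refine LinearMap.ker_eq_bot.1 (LinearMap.ker_eq_bot'.2 fun x hx => Subtype.ext ?_)
  refine ext_inner_of_dense A hd ?_
  rintro _ ⟨v, rfl⟩
  have hx0 : T x = 0 := hx
  rw [inner_adjoint_swap hT (T.mem_graph x) ((adjoint A T).mem_graph v), hx0]
  simp

variable [CompleteSpace E] [CompleteSpace F]

theorem IsRegular.isInvertible_iff (hT : IsRegular A T) :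
    IsInvertible A T ↔ DenseRange T ∧ DenseRange (HilbertModule.adjoint A T) := by
  constructor
  · rintro ⟨hi, hr⟩
    have hd : DenseRange T := by
      have := hr.dense_domain
      rwa [coe_inverse_domain] at this
    have hd' := hr.dense_adjoint_domain
    rw [coe_adjoint_inverse_domain hT.dense_domain hi hd] at hd'
    exact ⟨hd, hd'⟩
  · rintro ⟨hd, hd'⟩
    have hi := injective_of_denseRange_adjoint hT.dense_domain hd'
    refine ⟨hi, ?_, ?_, ?_, ?_, ?_⟩
    · refine isModuleLinear_iff.2 fun a u x h => ?_
      rw [mem_graph_inverse hi] at h ⊢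
      exact isModuleLinear_iff.1 hT.isModuleLinear a x u h
    · rwa [coe_inverse_domain]
    · exact (LinearPMap.inverse_closed_iff (LinearMap.ker_eq_bot.2 hi)).2 hT.isClosed
    · rwa [coe_adjoint_inverse_domain hT.dense_domain hi hd]
    · refine hT.dense_adjoint_domain.mono fun v hv => ?_
      obtain ⟨v', x, u, h1, h2, h3⟩ := hT.exists_add_eq hv
      -- The decomposition `v = v' + T T⋆ v'` read backwards: with `u = T T⋆ v'`, the adjoint of
      -- `T⁻¹` sends `T⁻¹ u = T⋆ v'` to `v'`.
      exact mem_rangeOneAddAdjointMul.2 ⟨u, x, v', (mem_graph_inverse hi).2 h2,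
        (mem_graph_adjoint_inverse hT.dense_domain hi hd).2 h1, by rw [add_comm, h3]⟩

end Inverse

/-! ### Bounded operators and invertibility of the transform -/

section Bounded

variable {z : E →L[ℂ] F} {w : F →L[ℂ] E}

theorem mem_graph_ofCLM {x : E} {u : F} : (x, u) ∈ (ofCLM z).graph ↔ z x = u := by
  rw [LinearPMap.mem_graph_iff]
  constructor
  · rintro ⟨x, rfl, rfl⟩; rfl
  · rintro rfl
    exact ⟨⟨x, trivial⟩, rfl, rfl⟩

theorem range_ofCLM : Set.range (ofCLM z) = Set.range z := by
  ext u
  rw [LinearPMap.mem_range_iff]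
  exact exists_congr fun x => mem_graph_ofCLM

theorem dense_ofCLM_domain : Dense ((ofCLM z).domain : Set E) := by
  simp [ofCLM]

theorem IsAdjointPair.adjoint_ofCLM (h : IsAdjointPair A z w) :
    adjoint A (ofCLM z) = ofCLM w := by
  refine LinearPMap.eq_of_eq_graph (Submodule.ext fun ⟨v, y⟩ => ?_)
  rw [mem_graph_adjoint_iff dense_ofCLM_domain, mem_graph_ofCLM]
  constructor
  · intro h1
    exact ext_inner A fun x => by rw [← h, h1 x _ (mem_graph_ofCLM.2 rfl)]
  · rintro rfl x u hx
    rw [← mem_graph_ofCLM.1 hx, h]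

variable [CompleteSpace E]

theorem IsAdjointPair.isRegular_ofCLM (h : IsAdjointPair A z w) : IsRegular A (ofCLM z) where
  isModuleLinear := isModuleLinear_iff.2 fun a x u hx => by
    rw [mem_graph_ofCLM] at hx ⊢
    rw [h.map_smul, hx]
  dense_domain := dense_ofCLM_domain
  isClosed := by
    have : ((ofCLM z).graph : Set (E × F)) = {p | z p.1 = p.2} := by
      ext p
      exact mem_graph_ofCLM
    rw [LinearPMap.IsClosed, this]
    exact isClosed_eq (by fun_prop) (by fun_prop)
  dense_adjoint_domain := by
    rw [h.adjoint_ofCLM]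
    exact dense_ofCLM_domain
  dense_range := by
    refine dense_univ.mono fun y _ => ?_
    obtain ⟨x, hx⟩ := h.surjective_smul_add one_pos y
    refine mem_rangeOneAddAdjointMul.2 ⟨x, z x, w (z x), mem_graph_ofCLM.2 rfl, ?_, ?_⟩
    · rw [h.adjoint_ofCLM]
      exact mem_graph_ofCLM.2 rfl
    · rwa [one_smul] at hx

theorem IsAdjointPair.isInvertible_ofCLM_iff [CompleteSpace F] (h : IsAdjointPair A z w) :
    IsInvertible A (ofCLM z) ↔ DenseRange z ∧ DenseRange w := by
  rw [h.isRegular_ofCLM.isInvertible_iff, h.adjoint_ofCLM]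
  simp only [DenseRange, range_ofCLM]

/-- A regular operator is invertible if and only if its bounded transform is. -/
theorem IsZTransform.isInvertible_iff [CompleteSpace F] {T : E →ₗ.[ℂ] F} (hT : IsRegular A T)
    (hz : IsZTransform A T z) : IsInvertible A T ↔ IsInvertible A (ofCLM z) := by
  obtain ⟨w, s, hz⟩ := hz.exists_isZData
  rw [hT.isInvertible_iff, hz.isAdjointPair.isInvertible_ofCLM_iff, hz.denseRange_iff]
  refine and_congr_right fun hd => ⟨fun h => ?_, fun h => ?_⟩
  -- `s T⋆ v = z⋆ v` on `D(T⋆)`, and `s` carries the dense range of `T⋆` to a dense set.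
  · have h1 := (hz.denseRange_sqrt hT.dense_domain).comp h s.continuous
    refine h1.mono ?_
    rintro _ ⟨v, rfl⟩
    refine ⟨v, ext_inner A fun x => ?_⟩
    rw [← hz.isAdjointPair, (mem_graph_adjoint_iff hT.dense_domain).1 ((adjoint A T).mem_graph v)
      _ _ (hz.mem_graph x), hz.isPositive.isAdjointPair]
    rfl
  · refine (h.comp hd w.continuous).mono ?_
    rintro _ ⟨y, rfl⟩
    exact LinearPMap.mem_range_iff.2 ⟨_, hz.mem_graph_adjoint hT.dense_domain y⟩

end Bounded

/-! ### Normal operators -/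

section Normal

theorem IsNormal.inner_eq {T : E →ₗ.[ℂ] E} (hn : IsNormal A T) {x x' a a' b b' : E} (ha : (x, a) ∈ T.graph)
    (ha' : (x', a') ∈ T.graph) (hb : (x, b) ∈ (adjoint A T).graph)
    (hb' : (x', b') ∈ (adjoint A T).graph) : inner A a a' = inner A b b' := by
  have key {x a b : E} (ha : (x, a) ∈ T.graph) (hb : (x, b) ∈ (adjoint A T).graph) :
      inner A a a = inner A b b := by
    have hd := LinearPMap.mem_domain_of_mem_graph ha
    have hd' := LinearPMap.mem_domain_of_mem_graph hb
    rw [← T.mem_graph_snd_inj (T.mem_graph ⟨x, hd⟩) ha rfl,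
      ← (adjoint A T).mem_graph_snd_inj ((adjoint A T).mem_graph ⟨x, hd'⟩) hb rfl]
    exact hn.2 x hd hd'
  have k (c : ℂ) : inner A (a + c • a') (a + c • a') = inner A (b + c • b') (b + c • b') :=
    key (T.graph.add_mem ha (T.graph.smul_mem c ha'))
    ((adjoint A T).graph.add_mem hb ((adjoint A T).graph.smul_mem c hb'))
  -- Polarization: `c = 1` gives the symmetric part and `c = i` the antisymmetric part.
  have k1 := k 1
  have k2 := k Complex.I
  simp only [CStarModule.inner_add_right, CStarModule.inner_add_left, inner_smul_right_complex,
    inner_smul_left_complex,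
    key ha hb, key ha' hb', one_smul, Complex.star_def, Complex.conj_I] at k1 k2
  have h1 : inner A a a' + inner A a' a = inner A b b' + inner A b' b := by
    linear_combination (norm := module) k1
  have h2 : inner A a a' - inner A a' a = inner A b b' - inner A b' b := by
    refine smul_right_injective A Complex.I_ne_zero ?_
    linear_combination (norm := module) k2
  refine smul_right_injective A (two_ne_zero (α := ℂ)) ?_
  linear_combination (norm := module) h1 + h2

variable [CompleteSpace E] [CompleteSpace F]

/-- The range of `T⋆` lies in the closure of the range of `T⋆T`. -/
theorem IsRegular.mem_closure_range_adjoint_mul {T : E →ₗ.[ℂ] F} (hT : IsRegular A T) {v : F}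
    {y : E} (hv : (v, y) ∈ (HilbertModule.adjoint A T).graph) :
    y ∈ closure {b | ∃ x u, (x, u) ∈ T.graph ∧ (u, b) ∈ (HilbertModule.adjoint A T).graph} := by
  obtain ⟨z, hz⟩ := hT.exists_isZTransform
  obtain ⟨w, s, hz⟩ := hz.exists_isZData
  refine Metric.mem_closure_iff.2 fun ε hε => ?_
  obtain ⟨d, hd, hdε⟩ : ∃ d : ℝ, 0 < d ∧ d * ‖v‖ < ε := by
    refine ⟨ε / (‖v‖ + 1), by positivity, ?_⟩
    rw [div_mul_eq_mul_div, div_lt_iff₀ (by positivity)]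
    nlinarith [norm_nonneg v]
  -- Setting `x = s² p` turns this into `d² x + (1 + d²) T⋆T x = y`. Pairing with `x` bounds `d x`
  -- by `‖v‖`, so the error `d² x` has norm at most `d ‖v‖ < ε`.
  obtain ⟨p, hp⟩ := hz.isAdjointPair.surjective_smul_add (c := d ^ 2) (by positivity) y
  have hx := hz.mem_graph (s p)
  have hu := hz.mem_graph_adjoint hT.dense_domain p
  have hss := hz.sqrt_sqrt_apply p
  set x := s (s p)
  set u := z (s p)
  set b := w (z p)
  have hy : y = d ^ 2 • x + (1 + d ^ 2) • b := by
    rw [← hp, hss]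
    module
  have h1 : inner A u v = inner A (d • x) (d • x) + inner A u u + inner A (d • u) (d • u) := by
    rw [(mem_graph_adjoint_iff hT.dense_domain).1 hv _ _ hx, hy, CStarModule.inner_add_right,
      inner_smul_right_real, inner_smul_right_real,
      ← (mem_graph_adjoint_iff hT.dense_domain).1 hu _ _ hx]
    simp only [inner_smul_right_real, inner_smul_left_real]
    module
  have hn1 : ‖u‖ ≤ ‖v‖ := by
    have h2 : inner A u u ≤ inner A u v := by
      rw [h1, add_right_comm]
      exact le_add_of_nonneg_left
        (add_nonneg CStarModule.inner_self_nonneg CStarModule.inner_self_nonneg)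
    have := norm_sq_le_of_inner_self_le A h2
    nlinarith [norm_nonneg u, norm_nonneg v]
  have hn2 : ‖d • x‖ ≤ ‖v‖ := by
    have h2 : inner A (d • x) (d • x) ≤ inner A u v := by
      rw [h1, add_assoc]
      exact le_add_of_nonneg_right
        (add_nonneg CStarModule.inner_self_nonneg CStarModule.inner_self_nonneg)
    have := norm_sq_le_of_inner_self_le A h2
    refine abs_le_of_sq_le_sq' (this.trans ?_) (norm_nonneg _) |>.2
    rw [sq]
    gcongr
  refine ⟨(1 + d ^ 2) • b, ⟨(1 + d ^ 2) • x, (1 + d ^ 2) • u, ?_, ?_⟩, ?_⟩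
  · exact T.graph.smul_of_tower_mem (1 + d ^ 2) hx
  · exact (HilbertModule.adjoint A T).graph.smul_of_tower_mem (1 + d ^ 2) hu
  · rw [dist_eq_norm, hy, add_sub_cancel_right, sq, mul_smul, norm_smul, Real.norm_of_nonneg hd.le]
    exact (mul_le_mul_of_nonneg_left hn2 hd.le).trans_lt hdε

variable {T : E →ₗ.[ℂ] E}

/-- A normal regular operator is invertible if and only if it has dense range. -/
theorem IsNormal.isInvertible_iff (hT : IsRegular A T) (hn : IsNormal A T) :
    IsInvertible A T ↔ DenseRange T := by
  rw [hT.isInvertible_iff]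
  refine ⟨fun h => h.1, fun h => ⟨h, ?_⟩⟩
  refine dense_closure.1 (h.mono ?_)
  rintro _ ⟨x, rfl⟩
  have hx : ((x : E), T x) ∈ (adjoint A (adjoint A T)).graph :=
    hT.adjoint_adjoint.symm ▸ T.mem_graph x
  refine closure_mono ?_ (hT.adjoint.mem_closure_range_adjoint_mul hx)
  rintro b ⟨v, y, hv, hy⟩
  rw [hT.adjoint_adjoint] at hy
  have hvd : v ∈ T.domain := hn.1 ▸ LinearPMap.mem_domain_of_mem_graph hv
  have hvT := T.mem_graph ⟨v, hvd⟩
  -- `T T⋆ v = T⋆ T v`, because `⟨T p, T v⟩ = ⟨T⋆ p, T⋆ v⟩ = ⟨p, T T⋆ v⟩` for `p ∈ D(T)`.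
  refine LinearPMap.mem_range_iff.2 ⟨T ⟨v, hvd⟩, (mem_graph_adjoint_iff hT.dense_domain).2 ?_⟩
  intro p q hpq
  have hp : p ∈ (adjoint A T).domain := hn.1 ▸ LinearPMap.mem_domain_of_mem_graph hpq
  have hp' := (adjoint A T).mem_graph ⟨p, hp⟩
  rw [hn.inner_eq hpq hvT hp' hv]
  exact inner_adjoint_swap hT.dense_domain hy hp'

end Normal

end HilbertModule

theorem mainTheorem3 {A E F : Type*}
    [NonUnitalCStarAlgebra A] [PartialOrder A] [StarOrderedRing A]
    [NormedAddCommGroup E] [NormedSpace ℂ E] [SMul A E] [CStarModule A E] [CompleteSpace E]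
    [NormedAddCommGroup F] [NormedSpace ℂ F] [SMul A F] [CStarModule A F] [CompleteSpace F] :
    -- `T` is invertible iff `T` and its adjoint have dense range
    (∀ T : E →ₗ.[ℂ] F, HilbertModule.IsRegular A T →
      (HilbertModule.IsInvertible A T ↔
        DenseRange T ∧ DenseRange (HilbertModule.adjoint A T))) ∧
    -- `T` has a unique `z`-transform, and `T` is invertible iff its `z`-transform is
    (∀ T : E →ₗ.[ℂ] F, HilbertModule.IsRegular A T →
      (∃! z : E →L[ℂ] F, HilbertModule.IsZTransform A T z) ∧
      ∀ z : E →L[ℂ] F, HilbertModule.IsZTransform A T z →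
        (HilbertModule.IsInvertible A T ↔
          HilbertModule.IsInvertible A (HilbertModule.ofCLM z))) ∧
    -- a normal `T` is invertible iff it has dense range
    (∀ T : E →ₗ.[ℂ] E, HilbertModule.IsRegular A T → HilbertModule.IsNormal A T →
      (HilbertModule.IsInvertible A T ↔ DenseRange T)) := by
  refine ⟨fun T hT => hT.isInvertible_iff, fun T hT => ⟨?_, fun z hz => hz.isInvertible_iff hT⟩,
    fun T hT hn => hn.isInvertible_iff hT⟩
  obtain ⟨z, hz⟩ := hT.exists_isZTransform
  exact ⟨z, hz, fun z' hz' => hz'.unique hT.dense_domain hz⟩
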